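/- **Setting.** All spaces are finite-dimensional complex Euclidean spaces. Fix $r$ and message spaces $\mathcal X_1,\dots,\mathcal X_r$ (from Bob to Alice) and $\mathcal Y_1,\dots,\mathcal Y_r$ (from Alice to Bob), and put $\mathcal X_{r+1}=\mathcal Z_0=\mathbb C$. A *pure strategy* $\tilde A$ of Alice consists of memory spaces $\mathcal Z_1,\dots,\mathcal Z_r$ and linear isometries $A_i:\mathcal X_i\otimes\mathcal Z_{i-1}\to\mathcal Y_i\otimes\mathcal Z_i$. A *pure co-strategy* $\tilde B$ of Bob consists of memory spaces $\mathcal W_0,\dots,\mathcal W_r$, a unit vector $|\beta\rangle\in\mathcal X_1\otimes\mathcal W_0$ and linear isometries $B_i:\mathcal Y_i\otimes\mathcal W_{i-1}\to\mathcal X_{i+1}\otimes\mathcal W_i$. Applying $A_1,B_1,\dots,A_r,B_r$ in turn to $|\beta\rangle$ gives the final state $|\psi(\tilde A,\tilde B)\rangle\in\mathcal Z_r\otimes\mathcal W_r$; write $\rho_{\tilde B}(A)=\mathrm{Tr}_{\mathcal Z_r}|\psi(\tilde A,\tilde B)\rangle\langle\psi(\tilde A,\tilde B)|$. With $F(P,Q)=\|\sqrt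 P\sqrt Q\|_1$, the *strategy fidelity* is $F_r(S,T)=\inf_{\tilde B}F(\rho_{\tilde B}(S),\rho_{\tilde B}(T))$ over all pure co-strategies $\tilde B$. **Protocol.** An interactive 1-out-of-2 quantum oblivious string transfer protocol for $n$-bit strings consists of honest pure strategies $\tilde A^0,\tilde A^1$ of Alice, for each $a\in\{0,1\}$ a measurement $\{\Pi^a_z\}_{z\in\{0,1\}^n}$ of the final memory of $\tilde A^a$, and, for each pair of strings $x=(x_0,x_1)$, a nonempty set $\mathcal B_x$ of pure co-strategies that Bob may use (Bob's actions need not be further specified), such that $\langle\psi(\tilde A^a,\tilde B)|\,\Pi^a_{x_a}\otimes I\,|\psi(\tilde A^a,\tilde B)\rangle=1$ for all $x$, all $\tilde B\in\mathcal B_x$ and both $a$: Alice, with choice bit $a$, learns $x_a$ with certainty. **Cheating probabilities.** * $B_{OT}$ is the supremum, over all pure co-strategies $\tilde B$ and all measurements $\{M_0,M_1\}$ of their final memory, of $\frac12\sum_{a}\langle\psi(\tilde A^a,\tilde B)|\,I\otimes M_a\,|\psi(\tilde A^a,\tilde B)\rangle$, the probability that Bob correctly guesses the uniformly random choice bit $a$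 of an honest Alice. * For $a\in\{0,1\}$ and $\bar a=1-a$, let $A_{OT}^{(a)}$ be the supremum, over all pure strategies of a dishonest Alice followed by a first measurement of her final memory whose outcome equals $x_a$ with certainty (for every $x$ and every $\tilde B\in\mathcal B_x$) and a second measurement of the post-measurement state, possibly depending on the first outcome, of the infimum over all $x$ and all $\tilde B\in\mathcal B_x$ of the probability that the outcome of the second measurement is $x_{\bar a}$. Put $A_{OT}=\max\{A_{OT}^{(0)},A_{OT}^{(1)}\}$. **Theorem.** In any interactive 1-out-of-2 quantum oblivious string transfer protocol, $$A_{OT}^{(a)}\ \ge\ F_r(A^0,A^1)^2\quad(a=0,1),\qquad\text{in particular } A_{OT}\ge F_r(A^0,A^1)^2,$$ $$\sqrt{A_{OT}}+2B_{OT}\ \ge\ 2,\qquad\text{and hence}\qquad \max\{A_{OT},B_{OT}\}\ \ge\ \frac{9-\sqrt{17}}{8}\approx 0.61 .$$ -/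

import Mathlib

open scoped Matrix Kronecker MatrixOrder ComplexOrder

noncomputable section

namespace StrategyFidelity

/-! ### Strategies, co-strategies and their interaction -/

/-- Dimensions of the message spaces of an `r`-round interaction: `x i` is the dimension of the
message space `X_{i+1}` from Bob to Alice (`0 ≤ i ≤ r`), `y i` that of the message space `Y_{i+1}`
from Alice to Bob (`0 ≤ i < r`). The space `X_{r+1}` is `ℂ`. A space of dimension `d` has the
standard basis `Fin d`. -/
structure MessageSpaces (r : ℕ) where
  x : Fin (r + 1) → ℕ
  y : Fin r → ℕ
  x_last : x (Fin.last r) = 1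

variable {r : ℕ}

/-- An `r`-round pure strategy (Alice): memory spaces `Z_0 = ℂ, Z_1, …, Z_r` and linear isometries
`A_{i+1} : X_{i+1} ⊗ Z_i → Y_{i+1} ⊗ Z_{i+1}`. -/
structure PureStrategy (D : MessageSpaces r) where
  mem : Fin (r + 1) → ℕ
  mem_zero : mem 0 = 1
  op : ∀ i : Fin r,
    Matrix (Fin (D.y i) × Fin (mem i.succ)) (Fin (D.x i.castSucc) × Fin (mem i.castSucc)) ℂ
  isometry : ∀ i, (op i)ᴴ * op i = 1

/-- An `r`-round pure co-strategy (Bob): memory spaces `W_0, …, W_r`, a unit vector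
`β ∈ X_1 ⊗ W_0`, and linear isometries `B_{i+1} : Y_{i+1} ⊗ W_i → X_{i+2} ⊗ W_{i+1}`. -/
structure PureCoStrategy (D : MessageSpaces r) where
  mem : Fin (r + 1) → ℕ
  init : Fin (D.x 0) × Fin (mem 0) → ℂ
  init_norm : ∑ p, ‖init p‖ ^ 2 = 1
  op : ∀ i : Fin r,
    Matrix (Fin (D.x i.succ) × Fin (mem i.succ)) (Fin (D.y i) × Fin (mem i.castSucc)) ℂ
  isometry : ∀ i, (op i)ᴴ * op i = 1

/-- Apply an operator `A : X ⊗ Z → Y ⊗ Z'` to a vector of `X ⊗ Z ⊗ W`. -/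
def aliceStep {X Z Y Z' W : Type*} [Fintype X] [Fintype Z]
    (A : Matrix (Y × Z') (X × Z) ℂ) (ψ : X × Z × W → ℂ) : Y × Z' × W → ℂ :=
  fun q => ∑ p : X × Z, A (q.1, q.2.1) p * ψ (p.1, p.2, q.2.2)

/-- Apply an operator `B : Y ⊗ W → X ⊗ W'` to a vector of `Y ⊗ Z ⊗ W`. -/
def bobStep {Y Z W X W' : Type*} [Fintype Y] [Fintype W]
    (B : Matrix (X × W') (Y × W) ℂ) (ψ : Y × Z × W → ℂ) : X × Z × W' → ℂ :=
  fun q => ∑ p : Y × W, B (q.1, q.2.2) p * ψ (p.1, q.2.1, p.2)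

variable {D : MessageSpaces r}

/-- The joint state in `X_{k+1} ⊗ Z_k ⊗ W_k` after `k` rounds. -/
def stateAfter (A : PureStrategy D) (B : PureCoStrategy D) (k : Fin (r + 1)) :
    Fin (D.x k) × Fin (A.mem k) × Fin (B.mem k) → ℂ :=
  Fin.induction
    (motive := fun k => Fin (D.x k) × Fin (A.mem k) × Fin (B.mem k) → ℂ)
    (fun q => B.init (q.1, q.2.2))
    (fun i ψ => bobStep (B.op i) (aliceStep (A.op i) ψ)) k

/-- The final state `|ψ(A, B)⟩ ∈ Z_r ⊗ W_r`; the only basis vector of `X_{r+1} = ℂ` is dropped. -/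
def finalState (A : PureStrategy D) (B : PureCoStrategy D) :
    Fin (A.mem (Fin.last r)) × Fin (B.mem (Fin.last r)) → ℂ :=
  fun q => stateAfter A B (Fin.last r) (⟨0, by rw [D.x_last]; exact Nat.one_pos⟩, q.1, q.2)

/-! ### Strategy fidelity -/

/-- The reduced operator `Tr_Z |ψ⟩⟨ψ|` on `W` of a vector `ψ ∈ Z ⊗ W`. -/
def reduced {Z W : Type*} [Fintype Z] (ψ : Z × W → ℂ) : Matrix W W ℂ :=
  Matrix.of fun w w' => ∑ z, ψ (z, w) * star (ψ (z, w'))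

/-- The trace norm `‖M‖₁ = Tr √(Mᴴ M)`. -/
def traceNorm {W : Type*} [Fintype W] [DecidableEq W] (M : Matrix W W ℂ) : ℝ :=
  (CFC.sqrt (Mᴴ * M)).trace.re

/-- The fidelity `F(P, Q) = ‖√P √Q‖₁` of positive semidefinite operators. -/
def fidelity {W : Type*} [Fintype W] [DecidableEq W] (P Q : Matrix W W ℂ) : ℝ :=
  traceNorm (CFC.sqrt P * CFC.sqrt Q)

/-- The strategy fidelity `F_r(S, T)`: the minimum, over all compatible co-strategies `B`, of the
fidelity of Bob's reduced final states after interacting with `S` and with `T`. -/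
def strategyFidelity (S T : PureStrategy D) : ℝ :=
  ⨅ B : PureCoStrategy D, fidelity (reduced (finalState S B)) (reduced (finalState T B))

/-! ### Measurements -/

/-- A measurement (POVM) on a space of dimension `d` with outcomes in `O`. -/
structure POVM (d : ℕ) (O : Type) [Fintype O] where
  elem : O → Matrix (Fin d) (Fin d) ℂ
  posSemidef : ∀ o, (elem o).PosSemidef
  sum_eq_one : ∑ o, elem o = 1

/-- The probability `⟨ψ| E ⊗ I |ψ⟩` of the effect `E` on Alice's part of `ψ ∈ Z ⊗ W`. -/
def aliceProb {Z W : Type*} [Fintype Z] [Fintype W] [DecidableEq W]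
    (E : Matrix Z Z ℂ) (ψ : Z × W → ℂ) : ℝ :=
  (star ψ ⬝ᵥ ((E ⊗ₖ (1 : Matrix W W ℂ)) *ᵥ ψ)).re

/-- The probability `⟨ψ| I ⊗ E |ψ⟩` of the effect `E` on Bob's part of `ψ ∈ Z ⊗ W`. -/
def bobProb {Z W : Type*} [Fintype Z] [Fintype W] [DecidableEq Z]
    (E : Matrix W W ℂ) (ψ : Z × W → ℂ) : ℝ :=
  (star ψ ⬝ᵥ (((1 : Matrix Z Z ℂ) ⊗ₖ E) *ᵥ ψ)).re

/-! ### Oblivious string transfer -/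

/-- Bit-strings of length `n`. -/
abbrev BitString (n : ℕ) : Type := Fin n → Bool

/-- An interactive 1-out-of-2 quantum oblivious string transfer protocol for strings of length `n`.
Choice bits are Booleans, and Bob's pair of strings is `x : Bool → BitString n`, so that
`x false` is the string with index 0 and `x true` the string with index 1.

Alice, with choice bit `a`, uses the pure strategy `alice a` and in the end measures her final memory
with `measure a`. Bob's actions need not be specified: `bob x` is the set of the pure co-strategies
that he may use when he holds `x`. It may be a single co-strategy (a fully specified Bob), or
contain all the co-strategies for which Alice gets the correct string. Alice always learns the
string of her choice with certainty. -/
structure OTProtocol (D : MessageSpaces r) (n : ℕ) where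
  alice : Bool → PureStrategy D
  measure : ∀ a, POVM ((alice a).mem (Fin.last r)) (BitString n)
  bob : (Bool → BitString n) → Set (PureCoStrategy D)
  bob_nonempty : ∀ x, (bob x).Nonempty
  correct : ∀ x, ∀ B ∈ bob x, ∀ a,
    aliceProb ((measure a).elem (x a)) (finalState (alice a) B) = 1

variable {n : ℕ}

/-- A dishonest Bob, who tries to learn Alice's choice bit: any pure co-strategy, followed by any
two-outcome measurement of his final memory. -/
structure CheatingBob (D : MessageSpaces r) where
  coStrategy : PureCoStrategy D
  guess : POVM (coStrategy.mem (Fin.last r)) Bool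

/-- The probability that a dishonest Bob guesses the uniformly random choice bit of an honest
Alice correctly. -/
def CheatingBob.success (C : CheatingBob D) (P : OTProtocol D n) : ℝ :=
  (1 / 2 : ℝ) * ∑ a : Bool, bobProb (C.guess.elem a) (finalState (P.alice a) C.coStrategy)

/-- Bob's cheating probability `B_OT`. -/
def OTProtocol.bobCheat (P : OTProtocol D n) : ℝ :=
  ⨆ C : CheatingBob D, C.success P

/-- A dishonest Alice, who learns the string with index `a` with certainty and then tries to learn
the other one. She uses any pure strategy. Then she measures her final memory with
measurement operators `first z`, whose outcome `z` is the string with index `a` with certainty,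
whatever strings Bob holds and whichever of his co-strategies he uses. Then she measures the
post-measurement state with any POVM `second z`, which may depend on `z`, to guess the other
string. -/
structure CheatingAlice (P : OTProtocol D n) (a : Bool) where
  strategy : PureStrategy D
  first : BitString n →
    Matrix (Fin (strategy.mem (Fin.last r))) (Fin (strategy.mem (Fin.last r))) ℂ
  first_complete : ∑ z, (first z)ᴴ * first z = 1
  second : BitString n → POVM (strategy.mem (Fin.last r)) (BitString n)
  certain : ∀ x, ∀ B ∈ P.bob x,
    aliceProb ((first (x a))ᴴ * first (x a)) (finalState strategy B) = 1

/-- The probability that a dishonest Alice obtains first `x a` and then the other string `x !a`,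
when Bob holds `x` and uses the co-strategy `B`. -/
def CheatingAlice.success {P : OTProtocol D n} {a : Bool} (C : CheatingAlice P a)
    (x : Bool → BitString n) (B : PureCoStrategy D) : ℝ :=
  aliceProb ((C.first (x a))ᴴ * (C.second (x a)).elem (x !a) * C.first (x a))
    (finalState C.strategy B)

/-- The probability with which a dishonest Alice is guaranteed to succeed. As she knows neither
Bob's strings nor which of his co-strategies he uses, this is an infimum over both. -/
def CheatingAlice.guaranteed {P : OTProtocol D n} {a : Bool} (C : CheatingAlice P a) : ℝ :=
  ⨅ q : {q : (Bool → BitString n) × PureCoStrategy D // q.2 ∈ P.bob q.1}, C.success q.1.1 q.1.2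

/-- Alice's cheating probability when she learns the string with index `a` with certainty and then
tries to learn the other one. -/
def OTProtocol.aliceCheatAfter (P : OTProtocol D n) (a : Bool) : ℝ :=
  ⨆ C : CheatingAlice P a, C.guaranteed

/-- Alice's cheating probability `A_OT`: she learns one string after learning the other one with
certainty, in either order. -/
def OTProtocol.aliceCheat (P : OTProtocol D n) : ℝ :=
  max (P.aliceCheatAfter true) (P.aliceCheatAfter false)

end StrategyFidelity

end

noncomputable section

namespace StrategyFidelity

/-! ### Matrix preliminaries -/

section Matrices

variable {k l m : Type*} [Fintype k] [Fintype l] [Fintype m]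

/-! For a fixed co-strategy, Uhlmann's theorem writes the fidelity of Bob's two reduced states as
`Re Tr (K G)`, with `K` a contraction on Alice's final memory and `G` the operator `crossReduced`,
which depends on Bob. A priori `K` depends on Bob too. But Bob can run two co-strategies in
superposition with a flag in his memory, and this averages their operators `G`; so the set of all
`G` is convex. The contractions form a compact convex set and the form is bilinear, so a minimax
argument yields one `K` with `Re Tr (K G)` at least the strategy fidelity against every co-strategy
(`exists_contraction_strategyFidelity`).

Dishonest Alice plays honestly with choice `a` and learns `x a`. That outcome is certain, so the
square-root measurement leaves the state intact. She then applies `K` and measures as with choice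
`!a`; Cauchy–Schwarz bounds her success below by the squared fidelity (`sq_re_trace_le_aliceProb`).

Dishonest Bob distinguishes the two reduced states by a Fuchs–van de Graaf measurement, so every
fidelity, hence their infimum, is at least `2 - 2 * P.bobCheat`. Eliminating the strategy fidelity
gives the tradeoff. -/

theorem re_trace_nonneg {A : Matrix m m ℂ} (hA : A.PosSemidef) : 0 ≤ A.trace.re :=
  (Complex.le_def.1 hA.trace_nonneg).1

theorem re_trace_conjTranspose (A : Matrix m m ℂ) : Aᴴ.trace.re = A.trace.re := by
  simp [Matrix.trace_conjTranspose]

variable [DecidableEq m]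

theorem posSemidef_sqrt (A : Matrix m m ℂ) : (CFC.sqrt A).PosSemidef :=
  Matrix.nonneg_iff_posSemidef.1 (CFC.sqrt_nonneg A)

theorem sqrt_mul_sqrt {A : Matrix m m ℂ} (hA : A.PosSemidef) : CFC.sqrt A * CFC.sqrt A = A :=
  CFC.sqrt_mul_sqrt_self A (Matrix.nonneg_iff_posSemidef.2 hA)

theorem re_trace_mul_nonneg {A B : Matrix m m ℂ} (hA : A.PosSemidef) (hB : B.PosSemidef) :
    0 ≤ (A * B).trace.re := by
  have h := (hB.conjTranspose_mul_mul_same (CFC.sqrt A))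
  rw [(posSemidef_sqrt A).isHermitian.eq] at h
  have := re_trace_nonneg h
  rwa [Matrix.trace_mul_comm, ← mul_assoc, sqrt_mul_sqrt hA] at this

/-- A contraction: an operator `V` with `Vᴴ V ≤ 1`. -/
def IsContraction (V : Matrix l m ℂ) : Prop := (1 - Vᴴ * V).PosSemidef

variable [DecidableEq l]

theorem IsContraction.mul {V : Matrix k l ℂ} {W : Matrix l m ℂ} (hV : IsContraction V)
    (hW : IsContraction W) : IsContraction (V * W) := by
  have h : 1 - (V * W)ᴴ * (V * W) = (1 - Wᴴ * W) + Wᴴ * (1 - Vᴴ * V) * W := by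
    simp only [Matrix.conjTranspose_mul, Matrix.mul_sub, Matrix.sub_mul, Matrix.mul_assoc,
      Matrix.mul_one]
    abel
  unfold IsContraction
  rw [h]
  exact Matrix.PosSemidef.add hW (Matrix.PosSemidef.conjTranspose_mul_mul_same hV W)

theorem IsContraction.conjTranspose {V : Matrix l m ℂ} (hV : IsContraction V) :
    IsContraction Vᴴ := by
  have h : 1 - Vᴴᴴ * Vᴴ = (1 - V * Vᴴ)ᴴ * (1 - V * Vᴴ) + V * (1 - Vᴴ * V) * Vᴴ := by
    simp only [Matrix.conjTranspose_conjTranspose, Matrix.conjTranspose_sub,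
      Matrix.conjTranspose_one, Matrix.conjTranspose_mul, Matrix.mul_sub, Matrix.sub_mul,
      Matrix.mul_assoc, Matrix.mul_one, Matrix.one_mul]
    abel
  unfold IsContraction
  rw [h]
  exact (Matrix.posSemidef_conjTranspose_mul_self _).add (hV.mul_mul_conjTranspose_same V)

theorem IsContraction.transpose {V : Matrix l m ℂ} (hV : IsContraction V) :
    IsContraction Vᵀ := by
  have h := Matrix.PosSemidef.transpose hV
  rw [Matrix.transpose_sub, Matrix.transpose_one, Matrix.transpose_mul] at h
  have h' : IsContraction (Vᴴᵀ) := by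
    unfold IsContraction
    have hV' : Vᴴᵀᴴ = Vᵀ := by
      ext i j
      simp
    rwa [hV']
  have hV' : Vᵀ = Vᴴᵀᴴ := by
    ext i j
    simp
  rw [hV']
  exact h'.conjTranspose

/-- A finite spectrum is discrete, so the functional calculus also accepts functions discontinuous
at 0, such as the inverse and the step function used below. -/
theorem continuousOn_spectrum (A : Matrix m m ℂ) (f : ℝ → ℝ) :
    ContinuousOn f (spectrum ℝ A) := A.finite_real_spectrum.continuousOn f

/-- The polar decomposition of `A`, with a contraction in place of a partial isometry. -/
theorem exists_contraction_mul_eq_sqrt (A : Matrix l m ℂ) :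
    ∃ V : Matrix m l ℂ, IsContraction V ∧ V * A = CFC.sqrt (Aᴴ * A) ∧
      Vᴴ * CFC.sqrt (Aᴴ * A) = A := by
  set H := CFC.sqrt (Aᴴ * A) with hH
  have hHp : H.PosSemidef := posSemidef_sqrt _
  have hHs : IsSelfAdjoint H := hHp.isHermitian
  have hHH : H * H = Aᴴ * A := sqrt_mul_sqrt (Matrix.posSemidef_conjTranspose_mul_self A)
  have hc := continuousOn_spectrum H
  have hid : cfc (fun x : ℝ => x) H = H := cfc_id' ℝ H
  -- As `0⁻¹ = 0`, this is the pseudo-inverse of `H`, and `J * H` is the projection onto the support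
  -- of `H`. The contraction will be `J * Aᴴ`.
  set J := cfc (fun x : ℝ => x⁻¹) H with hJ
  have hJs : Jᴴ = J := (cfc_predicate (fun x : ℝ => x⁻¹) H : IsSelfAdjoint _)
  have hJHH : J * (H * H) = H := by
    conv_lhs => rw [← hid]
    rw [hJ, ← cfc_mul _ _ H (hc _) (hc _), ← cfc_mul _ _ H (hc _) (hc _)]
    conv_rhs => rw [← hid]
    refine cfc_congr fun x _ => ?_
    by_cases hx : x = 0
    · simp [hx]
    · field_simp
  have hHJH : H * J * H = H := by
    conv_lhs => rw [← hid]
    rw [hJ, ← cfc_mul _ _ H (hc _) (hc _), ← cfc_mul _ _ H (hc _) (hc _)]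
    conv_rhs => rw [← hid]
    refine cfc_congr fun x _ => ?_
    by_cases hx : x = 0
    · simp [hx]
    · field_simp
  have hJH : J * H = cfc (fun x : ℝ => x⁻¹ * x) H := by
    conv_lhs => rw [← hid]
    rw [hJ, ← cfc_mul _ _ H (hc _) (hc _)]
  have hcomm : H * J = J * H := by
    rw [hJH]
    conv_lhs => rw [← hid]
    rw [hJ, ← cfc_mul _ _ H (hc _) (hc _)]
    exact cfc_congr fun x _ => mul_comm _ _
  have hE : (1 - J * H).PosSemidef := by
    rw [← Matrix.nonneg_iff_posSemidef, hJH, ← cfc_one ℝ H, ← cfc_sub _ _ H (hc _) (hc _)]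
    refine cfc_nonneg fun x _ => ?_
    by_cases hx : x = 0 <;> simp [hx]
  refine ⟨J * Aᴴ, ?_, by rw [Matrix.mul_assoc, ← hHH, hJHH], ?_⟩
  · have h : IsContraction (J * Aᴴ)ᴴ := by
      unfold IsContraction
      have : (J * Aᴴ)ᴴᴴ * (J * Aᴴ)ᴴ = J * H := by
        rw [Matrix.conjTranspose_conjTranspose, Matrix.conjTranspose_mul, hJs,
          Matrix.conjTranspose_conjTranspose, Matrix.mul_assoc, ← Matrix.mul_assoc Aᴴ, ← hHH,
          ← Matrix.mul_assoc, hJHH, hcomm]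
      rw [this]
      exact hE
    simpa using h.conjTranspose
  -- `A * (J * H - 1)` vanishes because its Gram matrix involves `Aᴴ * A = H * H`, and `H * (J * H -
  -- 1) = 0`.
  · rw [Matrix.conjTranspose_mul, hJs, Matrix.conjTranspose_conjTranspose, ← sub_eq_zero,
      ← Matrix.conjTranspose_mul_self_eq_zero]
    have h1 : A * J * H - A = A * (J * H - 1) := by
      rw [Matrix.mul_sub, Matrix.mul_one, Matrix.mul_assoc]
    have h2 : H * (J * H - 1) = 0 := by
      rw [Matrix.mul_sub, Matrix.mul_one, ← Matrix.mul_assoc, hHJH, sub_self]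
    rw [h1, Matrix.conjTranspose_mul, Matrix.mul_assoc, ← Matrix.mul_assoc Aᴴ, ← hHH,
      Matrix.mul_assoc H, h2, Matrix.mul_zero, Matrix.mul_zero]

/-- Write `A = Vᴴ * H`. Expanding `0 ≤ Tr ((V - 1) H (V - 1)ᴴ)` and using `Tr (Vᴴ V H) ≤ Tr H` gives
`2 Re Tr A ≤ 2 Tr H`. -/
theorem re_trace_le_traceNorm (A : Matrix m m ℂ) : A.trace.re ≤ traceNorm A := by
  obtain ⟨V, hV, -, hVA⟩ := exists_contraction_mul_eq_sqrt A
  set H := CFC.sqrt (Aᴴ * A) with hH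
  have hHp : H.PosSemidef := posSemidef_sqrt _
  have h1 := re_trace_nonneg (hHp.mul_mul_conjTranspose_same (V - 1))
  have h2 := re_trace_mul_nonneg hV hHp
  have h3 := re_trace_conjTranspose (Vᴴ * H)
  have h4 : (V * H * Vᴴ).trace = (Vᴴ * V * H).trace := by
    rw [Matrix.trace_mul_comm, Matrix.mul_assoc]
  have h5 : (H * Vᴴ).trace = (Vᴴ * H).trace := Matrix.trace_mul_comm _ _
  have h6 : (V * H).trace = (Vᴴ * H)ᴴ.trace := by
    rw [Matrix.conjTranspose_mul, Matrix.conjTranspose_conjTranspose, hHp.isHermitian.eq,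
      Matrix.trace_mul_comm]
  have h7 : traceNorm A = H.trace.re := rfl
  rw [h7]
  simp only [Matrix.conjTranspose_sub, Matrix.conjTranspose_one, Matrix.sub_mul, Matrix.mul_sub,
    Matrix.one_mul, Matrix.mul_one, Matrix.trace_sub, Complex.sub_re, h4, h5, h6, h3] at h1 h2
  rw [hVA] at h1
  linarith

variable [DecidableEq k]

/-- Uhlmann's theorem in matrix form: polar decompositions give `√(X Xᴴ) = V Xᴴ`, `√(Y Yᴴ) = Y Wᴴ`,
and a `U` turning the trace norm of their product into a trace; cyclicity collects `K = Wᴴ U V`. -/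
theorem exists_contraction_traceNorm (X : Matrix m k ℂ) (Y : Matrix m l ℂ) :
    ∃ K : Matrix l k ℂ, IsContraction K ∧
      fidelity (X * Xᴴ) (Y * Yᴴ) = (K * Xᴴ * Y).trace.re := by
  obtain ⟨V, hV, hVX, -⟩ := exists_contraction_mul_eq_sqrt Xᴴ
  obtain ⟨W, hW, hWY, -⟩ := exists_contraction_mul_eq_sqrt Yᴴ
  rw [Matrix.conjTranspose_conjTranspose] at hVX hWY
  obtain ⟨U, hU, hUA, -⟩ := exists_contraction_mul_eq_sqrt
    (CFC.sqrt (X * Xᴴ) * CFC.sqrt (Y * Yᴴ))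
  refine ⟨Wᴴ * U * V, (hW.conjTranspose.mul hU).mul hV, ?_⟩
  unfold fidelity traceNorm
  rw [← hUA]
  congr 1
  have h : CFC.sqrt (Y * Yᴴ) = Y * Wᴴ := by
    rw [← (posSemidef_sqrt (Y * Yᴴ)).isHermitian.eq, ← hWY]
    simp
  rw [h, ← hVX, ← Matrix.mul_assoc, ← Matrix.mul_assoc, Matrix.trace_mul_comm]
  simp only [Matrix.mul_assoc]

theorem fidelity_nonneg (P Q : Matrix m m ℂ) : 0 ≤ fidelity P Q :=
  re_trace_nonneg (posSemidef_sqrt _)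

/-- One of the Fuchs–van de Graaf inequalities. -/
theorem exists_effect_le_fidelity {P Q : Matrix m m ℂ} (hP : P.PosSemidef) (hQ : Q.PosSemidef) :
    ∃ M : Matrix m m ℂ, M.PosSemidef ∧ (1 - M).PosSemidef ∧
      P.trace.re + Q.trace.re - fidelity P Q ≤ (M * P).trace.re + ((1 - M) * Q).trace.re := by
  set p := CFC.sqrt P with hp
  set q := CFC.sqrt Q with hq
  have hpp : p * p = P := sqrt_mul_sqrt hP
  have hqq : q * q = Q := sqrt_mul_sqrt hQ
  have hps : p.PosSemidef := posSemidef_sqrt P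
  have hqs : q.PosSemidef := posSemidef_sqrt Q
  set T := p - q with hT
  have hTs : IsSelfAdjoint T := hps.isHermitian.sub hqs.isHermitian
  have hc := continuousOn_spectrum T
  have hid : cfc (fun x : ℝ => x) T = T := cfc_id' ℝ T
  -- `M` projects onto the nonnegative part of `√P - √Q`, so `M * T` and `M * T - T` are the
  -- positive and negative parts of `T`.
  let f : ℝ → ℝ := fun x => if 0 ≤ x then 1 else 0
  set M := cfc f T with hM
  have hMT : M * T = cfc (fun x => f x * x) T := by
    conv_lhs => rw [← hid]
    rw [hM, ← cfc_mul _ _ T (hc _) (hc _)]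
  have hTM : T * M = M * T := by
    rw [hMT]
    conv_lhs => rw [← hid]
    rw [hM, ← cfc_mul _ _ T (hc _) (hc _)]
    exact cfc_congr fun x _ => mul_comm _ _
  have hpos : (M * T).PosSemidef := by
    rw [← Matrix.nonneg_iff_posSemidef, hMT]
    refine cfc_nonneg fun x _ => ?_
    by_cases hx : 0 ≤ x <;> simp [f, hx]
  have hneg : (M * T - T).PosSemidef := by
    rw [← Matrix.nonneg_iff_posSemidef, hMT]
    nth_rewrite 2 [← hid]
    rw [← cfc_sub _ _ T (hc _) (hc _)]
    refine cfc_nonneg fun x _ => ?_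
    by_cases hx : 0 ≤ x
    · simp [f, hx]
    · simp [f, hx]; linarith
  refine ⟨M, ?_, ?_, ?_⟩
  · rw [← Matrix.nonneg_iff_posSemidef]
    refine cfc_nonneg fun x _ => ?_
    by_cases hx : 0 ≤ x <;> simp [f, hx]
  · rw [← Matrix.nonneg_iff_posSemidef, ← cfc_one ℝ T, ← cfc_sub _ _ T (hc _) (hc _)]
    refine cfc_nonneg fun x _ => ?_
    by_cases hx : 0 ≤ x <;> simp [f, hx]
  -- Pair the positive part with `q` and the negative part with `p`: on adding, the terms `Tr (M q
  -- p)` cancel, leaving `Tr P - Re Tr (p q) ≤ Re Tr (M P) - Re Tr (M Q)`.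
  · have h1 := re_trace_mul_nonneg hpos hqs
    have h2 := re_trace_mul_nonneg hneg hps
    have h3 : (p * q).trace.re ≤ fidelity P Q := re_trace_le_traceNorm _
    have h4 : (q * p).trace = (p * q).trace := Matrix.trace_mul_comm _ _
    have h5 : (p * M * q).trace = (M * (q * p)).trace := by
      rw [Matrix.mul_assoc, Matrix.trace_mul_comm, Matrix.mul_assoc]
    have h6 : (q * M * q).trace = (M * (q * q)).trace := by
      rw [Matrix.mul_assoc, Matrix.trace_mul_comm, Matrix.mul_assoc]
    rw [← hTM] at h1
    simp only [hT, Matrix.sub_mul, Matrix.mul_sub, Matrix.trace_sub,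
      Complex.sub_re, h4, h5, h6] at h1 h2
    rw [Matrix.mul_assoc, Matrix.mul_assoc M q p, hpp] at h2
    rw [hqq] at h1
    simp only [Matrix.sub_mul, Matrix.one_mul, Matrix.trace_sub, Complex.sub_re]
    linarith

end Matrices

/-! ### A minimax theorem for contractions -/

section Minimax

variable {k l : Type*} [Fintype k] [Fintype l] [DecidableEq k]

open scoped Matrix.Norms.L2Operator in
theorem isContraction_iff_norm_le_one (V : Matrix l k ℂ) : IsContraction V ↔ ‖V‖ ≤ 1 := by
  have h0 : (0 : Matrix k k ℂ) ≤ Vᴴ * V :=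
    Matrix.nonneg_iff_posSemidef.2 (Matrix.posSemidef_conjTranspose_mul_self V)
  have h1 := CStarAlgebra.norm_le_one_iff_of_nonneg (Vᴴ * V) h0
  rw [Matrix.l2_opNorm_conjTranspose_mul_self, Matrix.le_iff] at h1
  rw [IsContraction, ← h1]
  exact ⟨fun h => by nlinarith [norm_nonneg V], fun h => by nlinarith [norm_nonneg V]⟩

open scoped Matrix.Norms.L2Operator in
theorem setOf_isContraction_eq_closedBall :
    {V : Matrix l k ℂ | IsContraction V} = Metric.closedBall 0 1 :=
  Set.ext fun V => by simp [isContraction_iff_norm_le_one]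

open scoped Matrix.Norms.L2Operator in
theorem isCompact_setOf_isContraction : IsCompact {V : Matrix l k ℂ | IsContraction V} := by
  have : ProperSpace (Matrix l k ℂ) := FiniteDimensional.proper ℂ _
  rw [setOf_isContraction_eq_closedBall]
  exact isCompact_closedBall 0 1

open scoped Matrix.Norms.L2Operator in
theorem convex_setOf_isContraction : Convex ℝ {V : Matrix l k ℂ | IsContraction V} := by
  let : NormedSpace ℝ (Matrix l k ℂ) := NormedSpace.restrictScalars ℝ ℂ _
  rw [setOf_isContraction_eq_closedBall]
  exact convex_closedBall 0 1

/-- The real bilinear form `(K, G) ↦ Re Tr (K G)`. -/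
def reTraceForm (k l : Type*) [Fintype k] [Fintype l] :
    Matrix l k ℂ →ₗ[ℝ] Matrix k l ℂ →ₗ[ℝ] ℝ :=
  LinearMap.mk₂ ℝ (fun K G => (K * G).trace.re)
    (fun K K' G => by simp [Matrix.add_mul])
    (fun c K G => by simp)
    (fun K G G' => by simp [Matrix.mul_add])
    (fun c K G => by simp)

theorem exists_contraction_forall_le {C : Set (Matrix k l ℂ)} (hC : Convex ℝ C) {F : ℝ}
    (h : ∀ G ∈ C, ∃ K : Matrix l k ℂ, IsContraction K ∧ F ≤ (K * G).trace.re) :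
    ∃ K : Matrix l k ℂ, IsContraction K ∧ ∀ G ∈ C, F ≤ (K * G).trace.re := by
  by_contra! hne
  -- The sign puts the compact variable `K` on the infimum side of Sion's theorem.
  let f : Matrix l k ℂ →ₗ[ℝ] Matrix k l ℂ →ₗ[ℝ] ℝ := -reTraceForm k l
  have hf : ∀ K G, f K G = -(K * G).trace.re := fun _ _ => rfl
  have hcr : ∀ K, Continuous fun G => f K G := fun K => (f K).continuous_of_finiteDimensional
  have hcl : ∀ G, Continuous fun K => f K G := fun G =>
    (f.flip G).continuous_of_finiteDimensional
  -- If every `K` is beaten by some `G`, finitely many `G` suffice by compactness, and Sion's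
  -- theorem merges them into one `G` in `C` beating all `K`, against `h`. No compactness of `C` is
  -- needed.
  obtain ⟨t, ht⟩ := isCompact_setOf_isContraction.elim_finite_subcover
    (fun G : C => {K : Matrix l k ℂ | -F < f K G})
    (fun G => isOpen_lt continuous_const (hcl G))
    (fun K hK => by
      obtain ⟨G, hG, hlt⟩ := hne K hK
      exact Set.mem_iUnion.2 ⟨⟨G, hG⟩, by simpa [hf] using hlt⟩)
  obtain ⟨G, hG, hlt⟩ := Sion.exists_lt_iInf_of_lt_iInf_of_finite
    (X := {V : Matrix l k ℂ | IsContraction V}) (Y := C) (f := fun K G => f K G)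
    ⟨0, by simp [IsContraction, Matrix.PosSemidef.one]⟩ isCompact_setOf_isContraction
    (fun G _ => (hcl G).lowerSemicontinuous.lowerSemicontinuousOn _)
    (fun G _ => ((f.flip G).convexOn convex_setOf_isContraction).quasiconvexOn)
    hC
    (fun K _ => (hcr K).upperSemicontinuous.upperSemicontinuousOn _)
    (fun K _ => ((f K).concaveOn hC).quasiconcaveOn)
    convex_setOf_isContraction
    (s := Subtype.val '' (t : Set C)) (t.finite_toSet.image _) (by simp) (t := -F)
    (fun K hK => by simpa using ht hK)
  obtain ⟨K, hK, hle⟩ := h G hG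
  have := hlt K hK
  simp only [hf] at this
  linarith

end Minimax

variable {r : ℕ}
variable {D : MessageSpaces r}
variable {n : ℕ}

/-! ### Bipartite vectors as matrices -/

section Bipartite

variable {Z Z' W : Type*} [Fintype Z] [Fintype Z'] [Fintype W]

/-- A vector of `Z ⊗ W` as a `Z × W` matrix. -/
def coeffMatrix (ψ : Z × W → ℂ) : Matrix Z W ℂ := Matrix.of fun z w => ψ (z, w)

omit [Fintype W] in
theorem reduced_eq_coeffMatrix (ψ : Z × W → ℂ) :
    reduced ψ = (coeffMatrix ψ)ᵀ * ((coeffMatrix ψ)ᵀ)ᴴ := rfl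

theorem posSemidef_reduced (ψ : Z × W → ℂ) : (reduced ψ).PosSemidef := by
  rw [reduced_eq_coeffMatrix]
  exact Matrix.posSemidef_self_mul_conjTranspose _

theorem aliceProb_eq_trace [DecidableEq W] (E : Matrix Z Z ℂ) (ψ : Z × W → ℂ) :
    aliceProb E ψ = ((coeffMatrix ψ)ᴴ * E * coeffMatrix ψ).trace.re := by
  rw [aliceProb, Matrix.mul_assoc]
  congr 1
  simp only [dotProduct, Matrix.mulVec, Fintype.sum_prod_type, Matrix.kroneckerMap_apply,
    Matrix.one_apply, Matrix.trace, Matrix.diag,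
    Matrix.mul_apply, Matrix.conjTranspose_apply, coeffMatrix, Matrix.of_apply, Pi.star_apply]
  rw [Finset.sum_comm]
  simp

theorem bobProb_eq_trace [DecidableEq Z] (E : Matrix W W ℂ) (ψ : Z × W → ℂ) :
    bobProb E ψ = (E * reduced ψ).trace.re := by
  unfold bobProb
  congr 1
  simp only [dotProduct, Matrix.mulVec, Fintype.sum_prod_type, Matrix.kroneckerMap_apply,
    Matrix.one_apply, Matrix.trace, Matrix.diag, Matrix.mul_apply, reduced, Matrix.of_apply,
    Pi.star_apply, ite_mul, one_mul, zero_mul, Finset.sum_ite_irrel, Finset.sum_const_zero,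
    Finset.sum_ite_eq, Finset.mem_univ, if_true, Finset.mul_sum]
  rw [Finset.sum_comm]
  refine Finset.sum_congr rfl fun w _ => ?_
  rw [Finset.sum_comm]
  exact Finset.sum_congr rfl fun w' _ => Finset.sum_congr rfl fun z _ => by ring

theorem trace_reduced (ψ : Z × W → ℂ) : (reduced ψ).trace = ((∑ p, ‖ψ p‖ ^ 2 : ℝ) : ℂ) := by
  simp only [Matrix.trace, Matrix.diag, reduced, Matrix.of_apply]
  rw [Finset.sum_comm, Fintype.sum_prod_type]
  push_cast
  refine Finset.sum_congr rfl fun z _ => Finset.sum_congr rfl fun w _ => ?_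
  exact RCLike.mul_conj _

/-- The operator `Tr_W |ψ⟩⟨φ|` of vectors `φ ∈ Z ⊗ W` and `ψ ∈ Z' ⊗ W`. -/
def crossReduced (φ : Z × W → ℂ) (ψ : Z' × W → ℂ) : Matrix Z' Z ℂ :=
  coeffMatrix ψ * (coeffMatrix φ)ᴴ

/-- The transposed coefficient matrices purify the reduced states; transposing `K` back makes it act
on Alice's side. -/
theorem exists_contraction_fidelity_reduced [DecidableEq Z] [DecidableEq Z'] [DecidableEq W]
    (φ : Z × W → ℂ) (ψ : Z' × W → ℂ) :
    ∃ K : Matrix Z Z' ℂ, IsContraction K ∧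
      fidelity (reduced φ) (reduced ψ) = (K * crossReduced φ ψ).trace.re := by
  obtain ⟨K, hK, h⟩ := exists_contraction_traceNorm (coeffMatrix φ)ᵀ (coeffMatrix ψ)ᵀ
  refine ⟨Kᵀ, hK.transpose, ?_⟩
  rw [reduced_eq_coeffMatrix, reduced_eq_coeffMatrix, h, ← Matrix.trace_transpose,
    Matrix.transpose_mul, Matrix.transpose_mul, Matrix.transpose_transpose, ← Matrix.mul_assoc,
    Matrix.trace_mul_comm]
  rfl

end Bipartite

/-! ### Norms of the states of an interaction -/

theorem sum_norm_sq_mulVec {l m : Type*} [Fintype l] [Fintype m] [DecidableEq m]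
    {A : Matrix l m ℂ} (hA : Aᴴ * A = 1) (v : m → ℂ) :
    ∑ i, ‖(A *ᵥ v) i‖ ^ 2 = ∑ j, ‖v j‖ ^ 2 := by
  have h : star (A *ᵥ v) ⬝ᵥ (A *ᵥ v) = star v ⬝ᵥ v := by
    rw [Matrix.star_mulVec, ← Matrix.dotProduct_mulVec, Matrix.mulVec_mulVec, hA,
      Matrix.one_mulVec]
  have h' := congrArg Complex.re h
  simpa [dotProduct, Complex.re_sum, ← Complex.normSq_eq_conj_mul_self, Complex.normSq_eq_norm_sq,
    ← Complex.ofReal_pow] using h'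

theorem sum_norm_sq_aliceStep {X Z Y Z' W : Type*} [Fintype X] [Fintype Z] [Fintype Y]
    [Fintype Z'] [Fintype W] [DecidableEq X] [DecidableEq Z] {A : Matrix (Y × Z') (X × Z) ℂ}
    (hA : Aᴴ * A = 1) (ψ : X × Z × W → ℂ) :
    ∑ q, ‖aliceStep A ψ q‖ ^ 2 = ∑ p, ‖ψ p‖ ^ 2 := by
  have h : ∀ w, ∑ q : Y × Z', ‖aliceStep A ψ (q.1, q.2, w)‖ ^ 2
      = ∑ p : X × Z, ‖ψ (p.1, p.2, w)‖ ^ 2 :=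
    fun w => sum_norm_sq_mulVec hA fun p : X × Z => ψ (p.1, p.2, w)
  have h' := Finset.sum_congr (rfl : (Finset.univ : Finset W) = _) fun w _ => h w
  rw [Finset.sum_comm, Finset.sum_comm (s := (Finset.univ : Finset W))] at h'
  simpa [Fintype.sum_prod_type] using h'

theorem sum_norm_sq_bobStep {Y Z W X W' : Type*} [Fintype X] [Fintype Z] [Fintype Y]
    [Fintype W] [Fintype W'] [DecidableEq Y] [DecidableEq W] {B : Matrix (X × W') (Y × W) ℂ}
    (hB : Bᴴ * B = 1) (ψ : Y × Z × W → ℂ) :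
    ∑ q, ‖bobStep B ψ q‖ ^ 2 = ∑ p, ‖ψ p‖ ^ 2 := by
  have h : ∀ z, ∑ q : X × W', ‖bobStep B ψ (q.1, z, q.2)‖ ^ 2
      = ∑ p : Y × W, ‖ψ (p.1, z, p.2)‖ ^ 2 :=
    fun z => sum_norm_sq_mulVec hB fun p : Y × W => ψ (p.1, z, p.2)
  have h' := Finset.sum_congr (rfl : (Finset.univ : Finset Z) = _) fun z _ => h z
  simp only [Fintype.sum_prod_type] at h' ⊢
  rw [Finset.sum_comm, Finset.sum_comm (s := (Finset.univ : Finset Z))] at h'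
  exact h'

theorem stateAfter_zero (A : PureStrategy D) (B : PureCoStrategy D) :
    stateAfter A B 0 = fun q => B.init (q.1, q.2.2) := rfl

theorem stateAfter_succ (A : PureStrategy D) (B : PureCoStrategy D) (i : Fin r) :
    stateAfter A B i.succ =
      bobStep (B.op i) (aliceStep (A.op i) (stateAfter A B i.castSucc)) :=
  Fin.induction_succ ..

theorem sum_norm_sq_stateAfter (A : PureStrategy D) (B : PureCoStrategy D) (k : Fin (r + 1)) :
    ∑ q, ‖stateAfter A B k q‖ ^ 2 = 1 := by
  induction k using Fin.induction with
  | zero =>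
    have : Unique (Fin (A.mem 0)) := by rw [A.mem_zero]; infer_instance
    rw [stateAfter_zero, ← B.init_norm]
    simp [Fintype.sum_prod_type]
  | succ i ih =>
    rw [stateAfter_succ, sum_norm_sq_bobStep (B.isometry i), sum_norm_sq_aliceStep (A.isometry i),
      ih]

theorem sum_norm_sq_finalState (A : PureStrategy D) (B : PureCoStrategy D) :
    ∑ q, ‖finalState A B q‖ ^ 2 = 1 := by
  have h := sum_norm_sq_stateAfter A B (Fin.last r)
  let x₀ : Fin (D.x (Fin.last r)) := ⟨0, by rw [D.x_last]; exact Nat.one_pos⟩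
  have hx : ∀ x, x = x₀ := fun x => Fin.ext <| by
    exact Nat.lt_one_iff.1 (x.2.trans_eq D.x_last)
  rw [Fintype.sum_prod_type, Fintype.sum_eq_single x₀ fun x hne => absurd (hx x) hne] at h
  exact h

theorem re_trace_reduced_finalState (A : PureStrategy D) (B : PureCoStrategy D) :
    (reduced (finalState A B)).trace.re = 1 := by
  rw [trace_reduced, sum_norm_sq_finalState, Complex.ofReal_re]

/-! ### Mixtures of co-strategies -/

/-- The block diagonal operator on memories of the form `W₁ ⊕ W₂`. -/
def blockOp {X Y : Type*} {a b a' b' : ℕ} (M : Matrix (X × Fin a') (Y × Fin a) ℂ)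
    (N : Matrix (X × Fin b') (Y × Fin b) ℂ) :
    Matrix (X × Fin (a' + b')) (Y × Fin (a + b)) ℂ :=
  Matrix.of fun q p =>
    Fin.addCases
      (fun i => Fin.addCases (fun j => M (q.1, i) (p.1, j)) (fun _ => 0) p.2)
      (fun i => Fin.addCases (fun _ => 0) (fun j => N (q.1, i) (p.1, j)) p.2) q.2

theorem blockOp_isometry {X Y : Type*} [Fintype X] [Fintype Y] [DecidableEq Y] {a b a' b' : ℕ}
    {M : Matrix (X × Fin a') (Y × Fin a) ℂ} {N : Matrix (X × Fin b') (Y × Fin b) ℂ}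
    (hM : Mᴴ * M = 1) (hN : Nᴴ * N = 1) : (blockOp M N)ᴴ * blockOp M N = 1 := by
  ext ⟨y, w⟩ ⟨y', w'⟩
  have hM' := fun i j => congrFun (congrFun hM (y, i)) (y', j)
  have hN' := fun i j => congrFun (congrFun hN (y, i)) (y', j)
  simp only [Matrix.mul_apply, Matrix.conjTranspose_apply, Fintype.sum_prod_type,
    Matrix.one_apply, Prod.mk.injEq] at hM' hN'
  simp only [Matrix.mul_apply, Matrix.conjTranspose_apply, Fintype.sum_prod_type,
    Matrix.one_apply, Prod.mk.injEq, Fin.sum_univ_add]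
  refine Fin.addCases (fun i => ?_) (fun i => ?_) w <;>
    refine Fin.addCases (fun j => ?_) (fun j => ?_) w'
  · simpa [blockOp] using hM' i j
  · simp [blockOp, Fin.ext_iff]
    intro; omega
  · simp [blockOp, Fin.ext_iff]
    intro; omega
  · simpa [blockOp] using hN' i j

/-- The coherent mixture of two co-strategies: Bob keeps in his memory which of the two he uses. -/
def PureCoStrategy.mix (B C : PureCoStrategy D) (s t : ℝ) (h : s ^ 2 + t ^ 2 = 1) :
    PureCoStrategy D where
  mem k := B.mem k + C.mem k
  init p := Fin.addCases (fun j => s * B.init (p.1, j)) (fun j => t * C.init (p.1, j)) p.2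
  init_norm := by
    have hB := B.init_norm
    have hC := C.init_norm
    rw [Fintype.sum_prod_type] at hB hC ⊢
    simp only [Fin.sum_univ_add, Fin.addCases_left, Fin.addCases_right, norm_mul, mul_pow,
      Finset.sum_add_distrib, ← Finset.mul_sum, hB, hC]
    simpa using h
  op i := blockOp (B.op i) (C.op i)
  isometry i := blockOp_isometry (B.isometry i) (C.isometry i)

theorem aliceStep_apply_eq_mul {X Z Y Z' W W' : Type*} [Fintype X] [Fintype Z]
    (A : Matrix (Y × Z') (X × Z) ℂ) {ψ : X × Z × W → ℂ} {φ : X × Z × W' → ℂ} {w : W} {w' : W'}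
    {s : ℂ} (h : ∀ x z, ψ (x, z, w) = s * φ (x, z, w')) (y : Y) (z : Z') :
    aliceStep A ψ (y, z, w) = s * aliceStep A φ (y, z, w') := by
  simp only [aliceStep, h, Finset.mul_sum]
  exact Finset.sum_congr rfl fun _ _ => by ring

/-- Alice does not touch Bob's memory and Bob's operators are block diagonal, so the two branches
evolve independently and keep their amplitudes. -/
theorem stateAfter_mix (A : PureStrategy D) (B C : PureCoStrategy D) (s t : ℝ)
    (h : s ^ 2 + t ^ 2 = 1) (k : Fin (r + 1)) :
    (∀ x z j, stateAfter A (B.mix C s t h) k (x, z, Fin.castAdd (C.mem k) j)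
      = s * stateAfter A B k (x, z, j)) ∧
    (∀ x z j, stateAfter A (B.mix C s t h) k (x, z, Fin.natAdd (B.mem k) j)
      = t * stateAfter A C k (x, z, j)) := by
  induction k using Fin.induction with
  | zero =>
    constructor <;> intro x z j <;> simp [stateAfter_zero, PureCoStrategy.mix]
  | succ i ih =>
    obtain ⟨ihB, ihC⟩ := ih
    have hB := fun j => aliceStep_apply_eq_mul (A.op i) fun x z => ihB x z j
    have hC := fun j => aliceStep_apply_eq_mul (A.op i) fun x z => ihC x z j
    simp only [stateAfter_succ]
    constructor
    · intro x z j
      calc _ = ∑ y, ∑ w, blockOp (B.op i) (C.op i) (x, Fin.castAdd _ j) (y, w) *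
              aliceStep (A.op i) (stateAfter A (B.mix C s t h) i.castSucc) (y, z, w) :=
            Fintype.sum_prod_type _
        _ = s * ∑ y, ∑ w, B.op i (x, j) (y, w) *
              aliceStep (A.op i) (stateAfter A B i.castSucc) (y, z, w) := by
            rw [Finset.mul_sum]
            refine Finset.sum_congr rfl fun y _ => ?_
            refine (Fin.sum_univ_add _).trans ?_
            simp [blockOp, hB, Finset.mul_sum, mul_left_comm]
        _ = _ := by rw [← Fintype.sum_prod_type']; rfl
    · intro x z j
      calc _ = ∑ y, ∑ w, blockOp (B.op i) (C.op i) (x, Fin.natAdd _ j) (y, w) *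
              aliceStep (A.op i) (stateAfter A (B.mix C s t h) i.castSucc) (y, z, w) :=
            Fintype.sum_prod_type _
        _ = t * ∑ y, ∑ w, C.op i (x, j) (y, w) *
              aliceStep (A.op i) (stateAfter A C i.castSucc) (y, z, w) := by
            rw [Finset.mul_sum]
            refine Finset.sum_congr rfl fun y _ => ?_
            refine (Fin.sum_univ_add _).trans ?_
            simp [blockOp, hC, Finset.mul_sum, mul_left_comm]
        _ = _ := by rw [← Fintype.sum_prod_type']; rfl

theorem finalState_mix (A : PureStrategy D) (B C : PureCoStrategy D) (s t : ℝ)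
    (h : s ^ 2 + t ^ 2 = 1) :
    (∀ z j, finalState A (B.mix C s t h) (z, Fin.castAdd (C.mem (Fin.last r)) j)
      = s * finalState A B (z, j)) ∧
    (∀ z j, finalState A (B.mix C s t h) (z, Fin.natAdd (B.mem (Fin.last r)) j)
      = t * finalState A C (z, j)) :=
  have hm := stateAfter_mix A B C s t h (Fin.last r)
  ⟨fun z j => hm.1 _ z j, fun z j => hm.2 _ z j⟩

/-- The sum over Bob's memory splits over the two blocks, so no interference terms arise and the
amplitudes enter squared. -/
theorem crossReduced_mix (S T : PureStrategy D) (B C : PureCoStrategy D) (s t : ℝ)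
    (h : s ^ 2 + t ^ 2 = 1) :
    crossReduced (finalState S (B.mix C s t h)) (finalState T (B.mix C s t h)) =
      s ^ 2 • crossReduced (finalState S B) (finalState T B) +
      t ^ 2 • crossReduced (finalState S C) (finalState T C) := by
  ext z z'
  obtain ⟨hSB, hSC⟩ := finalState_mix S B C s t h
  obtain ⟨hTB, hTC⟩ := finalState_mix T B C s t h
  refine (Fin.sum_univ_add _).trans (congrArg₂ (· + ·) ?_ ?_)
  · rw [Matrix.smul_apply, crossReduced, Matrix.mul_apply, Finset.smul_sum]
    refine Finset.sum_congr rfl fun w _ => ?_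
    refine (congrArg₂ (fun u v => u * star v) (hTB z w) (hSB z' w)).trans ?_
    simp [coeffMatrix]
    ring
  · rw [Matrix.smul_apply, crossReduced, Matrix.mul_apply, Finset.smul_sum]
    refine Finset.sum_congr rfl fun w _ => ?_
    refine (congrArg₂ (fun u v => u * star v) (hTC z w) (hSC z' w)).trans ?_
    simp [coeffMatrix]
    ring

theorem convex_range_crossReduced (S T : PureStrategy D) :
    Convex ℝ (Set.range fun B : PureCoStrategy D =>
      crossReduced (finalState S B) (finalState T B)) := by
  rintro _ ⟨B, rfl⟩ _ ⟨C, rfl⟩ a b ha hb hab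
  refine ⟨B.mix C (√a) (√b) (by rw [Real.sq_sqrt ha, Real.sq_sqrt hb, hab]), ?_⟩
  dsimp only
  rw [crossReduced_mix, Real.sq_sqrt ha, Real.sq_sqrt hb]

theorem strategyFidelity_nonneg (S T : PureStrategy D) : 0 ≤ strategyFidelity S T :=
  Real.iInf_nonneg fun _ => fidelity_nonneg _ _

theorem strategyFidelity_le (S T : PureStrategy D) (B : PureCoStrategy D) :
    strategyFidelity S T ≤ fidelity (reduced (finalState S B)) (reduced (finalState T B)) :=
  ciInf_le ⟨0, by rintro _ ⟨B, rfl⟩; exact fidelity_nonneg _ _⟩ B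

/-- The strategy version of Uhlmann's theorem: one contraction of Alice's final memory is good
against every co-strategy. -/
theorem exists_contraction_strategyFidelity (S T : PureStrategy D) :
    ∃ K : Matrix (Fin (S.mem (Fin.last r))) (Fin (T.mem (Fin.last r))) ℂ, IsContraction K ∧
      ∀ B : PureCoStrategy D, strategyFidelity S T ≤
        (K * crossReduced (finalState S B) (finalState T B)).trace.re := by
  obtain ⟨K, hK, h⟩ := exists_contraction_forall_le (convex_range_crossReduced S T)
    (F := strategyFidelity S T) (by
      rintro _ ⟨B, rfl⟩
      obtain ⟨K, hK, h⟩ := exists_contraction_fidelity_reduced (finalState S B) (finalState T B)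
      exact ⟨K, hK, h ▸ strategyFidelity_le S T B⟩)
  exact ⟨K, hK, fun B => h _ ⟨B, rfl⟩⟩

/-- The adjoint contraction converts in the opposite direction; both directions are needed, one for
each choice bit. -/
theorem exists_contraction_strategyFidelity_swap (S T : PureStrategy D) :
    ∃ K : Matrix (Fin (T.mem (Fin.last r))) (Fin (S.mem (Fin.last r))) ℂ, IsContraction K ∧
      ∀ B : PureCoStrategy D, strategyFidelity S T ≤
        (K * crossReduced (finalState T B) (finalState S B)).trace.re := by
  obtain ⟨K, hK, h⟩ := exists_contraction_strategyFidelity S T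
  refine ⟨Kᴴ, hK.conjTranspose, fun B => (h B).trans_eq ?_⟩
  rw [← re_trace_conjTranspose, Matrix.conjTranspose_mul, Matrix.trace_mul_comm, crossReduced,
    crossReduced, Matrix.conjTranspose_mul, Matrix.conjTranspose_conjTranspose]

/-! ### Probabilities -/

section Probabilities

variable {Z Z' W : Type*} [Fintype Z] [Fintype Z'] [Fintype W]

theorem re_trace_conjTranspose_mul_self_coeffMatrix (ψ : Z × W → ℂ) :
    ((coeffMatrix ψ)ᴴ * coeffMatrix ψ).trace.re = (reduced ψ).trace.re := by
  rw [reduced_eq_coeffMatrix, ← Matrix.trace_transpose, Matrix.transpose_mul]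
  rfl

variable [DecidableEq W]

theorem aliceProb_nonneg {E : Matrix Z Z ℂ} (hE : E.PosSemidef) (ψ : Z × W → ℂ) :
    0 ≤ aliceProb E ψ := by
  rw [aliceProb_eq_trace]
  exact re_trace_nonneg (hE.conjTranspose_mul_mul_same _)

theorem aliceProb_mono {E E' : Matrix Z Z ℂ} (h : (E' - E).PosSemidef) (ψ : Z × W → ℂ) :
    aliceProb E ψ ≤ aliceProb E' ψ := by
  have := aliceProb_nonneg h ψ
  simpa only [aliceProb_eq_trace, Matrix.mul_sub, Matrix.sub_mul, Matrix.trace_sub,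
    Complex.sub_re, sub_nonneg] using this

theorem aliceProb_conj_of_mul_coeffMatrix_eq (E : Matrix Z Z ℂ) {R : Matrix Z Z ℂ}
    {ψ : Z × W → ℂ} (h : R * coeffMatrix ψ = coeffMatrix ψ) :
    aliceProb (Rᴴ * E * R) ψ = aliceProb E ψ := by
  rw [aliceProb_eq_trace, aliceProb_eq_trace]
  nth_rewrite 3 4 [← h]
  simp only [Matrix.conjTranspose_mul, Matrix.mul_assoc]

variable [DecidableEq Z]

/-- An effect that occurs with certainty leaves the state unchanged. -/
theorem sqrt_mul_coeffMatrix_of_aliceProb_eq_one {E : Matrix Z Z ℂ} (hE : E.PosSemidef)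
    (hE' : (1 - E).PosSemidef) {ψ : Z × W → ℂ} (hψ : (reduced ψ).trace.re = 1)
    (h : aliceProb E ψ = 1) : CFC.sqrt E * coeffMatrix ψ = coeffMatrix ψ := by
  set M := coeffMatrix ψ with hM
  have key : ∀ N : Matrix Z W ℂ, (Nᴴ * N).trace.re ≤ 0 → N = 0 := by
    intro N hN
    have h0 := Complex.le_def.1 (Matrix.posSemidef_conjTranspose_mul_self N).trace_nonneg
    rw [← Matrix.trace_conjTranspose_mul_self_eq_zero_iff]
    exact Complex.ext (le_antisymm hN h0.1) h0.2.symm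
  have hEM : E * M = M := by
    set R := CFC.sqrt (1 - E) with hR
    have hRR : R * R = 1 - E := sqrt_mul_sqrt hE'
    have hRs : Rᴴ = R := (posSemidef_sqrt (1 - E)).isHermitian
    have hRM : R * M = 0 := by
      apply key
      have h1 : (Mᴴ * M).trace.re = 1 :=
        (re_trace_conjTranspose_mul_self_coeffMatrix ψ).trans hψ
      rw [aliceProb_eq_trace, ← hM] at h
      rw [Matrix.conjTranspose_mul, hRs, Matrix.mul_assoc, ← Matrix.mul_assoc R, hRR,
        Matrix.sub_mul, Matrix.one_mul, Matrix.mul_sub, ← Matrix.mul_assoc, Matrix.trace_sub,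
        Complex.sub_re, h1, h, sub_self]
    have h2 : (1 - E) * M = 0 := by rw [← hRR, Matrix.mul_assoc, hRM, Matrix.mul_zero]
    rw [Matrix.sub_mul, Matrix.one_mul, sub_eq_zero] at h2
    exact h2.symm
  set Q := CFC.sqrt E with hQ
  have hQQ : Q * Q = E := sqrt_mul_sqrt hE
  have hQp : Q.PosSemidef := posSemidef_sqrt E
  -- `Q * M - M` would lie in the eigenspace of `Q` for the eigenvalue -1, which is trivial since
  -- `Q` is positive semidefinite.
  have hN : Q * (Q * M - M) = -(Q * M - M) := by
    rw [Matrix.mul_sub, ← Matrix.mul_assoc, hQQ, hEM, neg_sub]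
  rw [← sub_eq_zero]
  apply key
  have h3 := re_trace_nonneg (hQp.conjTranspose_mul_mul_same (Q * M - M))
  rw [Matrix.mul_assoc, hN, Matrix.mul_neg, Matrix.trace_neg, Complex.neg_re] at h3
  linarith

/-- Certainty of `E` on `φ` gives `√E N = N`, so the trace equals `Tr (Nᴴ X)` with `X = √E K M`;
Cauchy–Schwarz against `N`, of norm one, bounds its squared real part by `Tr (Xᴴ X)`. -/
theorem sq_re_trace_le_aliceProb (K : Matrix Z Z' ℂ) {E : Matrix Z Z ℂ}
    (hE : E.PosSemidef) (hE' : (1 - E).PosSemidef) {φ : Z × W → ℂ} (hφ : (reduced φ).trace.re = 1)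
    (h : aliceProb E φ = 1) (ψ : Z' × W → ℂ) :
    (K * crossReduced φ ψ).trace.re ^ 2 ≤ aliceProb (Kᴴ * E * K) ψ := by
  have hN := sqrt_mul_coeffMatrix_of_aliceProb_eq_one hE hE' hφ h
  have hN1 := (re_trace_conjTranspose_mul_self_coeffMatrix φ).trans hφ
  rw [aliceProb_eq_trace, crossReduced]
  set M := coeffMatrix ψ
  set N := coeffMatrix φ
  set Q := CFC.sqrt E with hQ
  have hQQ : Q * Q = E := sqrt_mul_sqrt hE
  have hQs : Qᴴ = Q := (posSemidef_sqrt E).isHermitian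
  set X := Q * K * M with hX
  have h1 : (K * (M * Nᴴ)).trace = (Nᴴ * X).trace := by
    nth_rewrite 1 [← hN]
    rw [Matrix.conjTranspose_mul, hQs, hX, ← Matrix.mul_assoc, Matrix.trace_mul_comm]
    simp only [Matrix.mul_assoc]
  have h2 : Mᴴ * (Kᴴ * E * K) * M = Xᴴ * X := by
    rw [hX, ← hQQ]
    simp only [Matrix.conjTranspose_mul, hQs, Matrix.mul_assoc]
  rw [h1, h2]
  have h3 : (Xᴴ * N).trace.re = (Nᴴ * X).trace.re := by
    rw [← re_trace_conjTranspose, Matrix.conjTranspose_mul, Matrix.conjTranspose_conjTranspose]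
  set c := (Nᴴ * X).trace.re with hc
  have h4 := re_trace_nonneg (Matrix.posSemidef_conjTranspose_mul_self (X - c • N))
  simp only [Matrix.conjTranspose_sub, Matrix.conjTranspose_smul, Matrix.sub_mul, Matrix.mul_sub,
    Matrix.smul_mul, Matrix.mul_smul, Matrix.trace_sub, Matrix.trace_smul, Complex.sub_re,
    Complex.smul_re, smul_eq_mul, h3, hN1, star_trivial, ← hc] at h4
  nlinarith

end Probabilities

theorem POVM.posSemidef_one_sub {d : ℕ} {O : Type} [Fintype O] (M : POVM d O) (o : O) :
    (1 - M.elem o).PosSemidef := by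
  classical
  rw [← M.sum_eq_one, ← Finset.add_sum_erase _ _ (Finset.mem_univ o), add_sub_cancel_left]
  exact Matrix.posSemidef_sum _ fun i _ => M.posSemidef i

/-- The measurement that applies the contraction `K` and then `M`; the outcome is `o₀` if `K`
fails. -/
def POVM.comp {d e : ℕ} {O : Type} [Fintype O] [DecidableEq O] (M : POVM e O)
    (K : Matrix (Fin e) (Fin d) ℂ) (hK : IsContraction K) (o₀ : O) : POVM d O where
  elem o := Kᴴ * M.elem o * K + if o = o₀ then 1 - Kᴴ * K else 0
  posSemidef o := by
    refine ((M.posSemidef o).conjTranspose_mul_mul_same K).add ?_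
    split_ifs
    · exact hK
    · exact Matrix.PosSemidef.zero
  sum_eq_one := by
    rw [Finset.sum_add_distrib, ← Matrix.sum_mul, ← Matrix.mul_sum, M.sum_eq_one]
    simp

/-! ### Dishonest Alice -/

theorem CheatingAlice.success_nonneg {P : OTProtocol D n} {a : Bool} (C : CheatingAlice P a)
    (x : Bool → BitString n) (B : PureCoStrategy D) : 0 ≤ C.success x B :=
  aliceProb_nonneg (((C.second _).posSemidef _).conjTranspose_mul_mul_same _) _

theorem CheatingAlice.success_le_one {P : OTProtocol D n} {a : Bool} (C : CheatingAlice P a)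
    {x : Bool → BitString n} {B : PureCoStrategy D} (hB : B ∈ P.bob x) : C.success x B ≤ 1 := by
  rw [← C.certain x B hB]
  refine aliceProb_mono ?_ _
  have h := ((C.second (x a)).posSemidef_one_sub (x !a)).conjTranspose_mul_mul_same
    (C.first (x a))
  simpa only [Matrix.mul_sub, Matrix.sub_mul, Matrix.mul_one] using h

theorem CheatingAlice.guaranteed_le_success {P : OTProtocol D n} {a : Bool}
    (C : CheatingAlice P a) {x : Bool → BitString n} {B : PureCoStrategy D} (hB : B ∈ P.bob x) :
    C.guaranteed ≤ C.success x B :=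
  ciInf_le (f := fun q : {q : (Bool → BitString n) × PureCoStrategy D // q.2 ∈ P.bob q.1} =>
    C.success q.1.1 q.1.2) ⟨0, by rintro _ ⟨q, rfl⟩; exact C.success_nonneg _ _⟩ ⟨(x, B), hB⟩

theorem CheatingAlice.guaranteed_le_aliceCheatAfter {P : OTProtocol D n} {a : Bool}
    (C : CheatingAlice P a) : C.guaranteed ≤ P.aliceCheatAfter a := by
  refine le_ciSup (f := fun C : CheatingAlice P a => C.guaranteed) ⟨1, ?_⟩ C
  rintro _ ⟨C, rfl⟩
  -- A real supremum dominates its members only if the family is bounded; one admissible co-strategy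
  -- already bounds each guarantee by 1.
  obtain ⟨B, hB⟩ := P.bob_nonempty fun _ _ => false
  exact (C.guaranteed_le_success hB).trans (C.success_le_one hB)

/-- Alice behaves honestly, measures to learn the string with index `a`, applies the contraction
`K` and measures as an honest Alice with choice bit `!a`. -/
def OTProtocol.convertingAlice (P : OTProtocol D n) (a : Bool)
    (K : Matrix (Fin ((P.alice !a).mem (Fin.last r))) (Fin ((P.alice a).mem (Fin.last r))) ℂ)
    (hK : IsContraction K) : CheatingAlice P a where
  strategy := P.alice a
  first z := CFC.sqrt ((P.measure a).elem z)
  first_complete := by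
    rw [← (P.measure a).sum_eq_one]
    refine Finset.sum_congr rfl fun z _ => ?_
    rw [(posSemidef_sqrt _).isHermitian.eq, sqrt_mul_sqrt ((P.measure a).posSemidef z)]
  -- The string announced when `K` fails is arbitrary: it can only add to the success probability.
  second _ := (P.measure !a).comp K hK fun _ => false
  certain x B hB := by
    rw [(posSemidef_sqrt _).isHermitian.eq, sqrt_mul_sqrt ((P.measure a).posSemidef _)]
    exact P.correct x B hB a

theorem OTProtocol.sq_le_success_convertingAlice (P : OTProtocol D n) (a : Bool)
    {K : Matrix (Fin ((P.alice !a).mem (Fin.last r))) (Fin ((P.alice a).mem (Fin.last r))) ℂ}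
    (hK : IsContraction K) {x : Bool → BitString n} {B : PureCoStrategy D} (hB : B ∈ P.bob x) :
    (K * crossReduced (finalState (P.alice !a) B) (finalState (P.alice a) B)).trace.re ^ 2 ≤
      (P.convertingAlice a K hK).success x B := by
  refine (sq_re_trace_le_aliceProb K ((P.measure !a).posSemidef (x !a))
    ((P.measure !a).posSemidef_one_sub (x !a)) (re_trace_reduced_finalState _ B)
    (P.correct x B hB !a) (finalState (P.alice a) B)).trans ?_
  have hM := sqrt_mul_coeffMatrix_of_aliceProb_eq_one ((P.measure a).posSemidef (x a))
    ((P.measure a).posSemidef_one_sub (x a)) (re_trace_reduced_finalState _ B)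
    (P.correct x B hB a)
  have h : (P.convertingAlice a K hK).success x B = aliceProb
      (((P.measure !a).comp K hK fun _ => false).elem (x !a)) (finalState (P.alice a) B) :=
    aliceProb_conj_of_mul_coeffMatrix_eq _ hM
  rw [h]
  refine aliceProb_mono ?_ _
  simp only [POVM.comp, add_sub_cancel_left]
  split_ifs
  · exact hK
  · exact Matrix.PosSemidef.zero

theorem OTProtocol.sq_strategyFidelity_le_aliceCheatAfter (P : OTProtocol D n) (a : Bool) :
    strategyFidelity (P.alice false) (P.alice true) ^ 2 ≤ P.aliceCheatAfter a := by
  obtain ⟨K, hK, h⟩ : ∃ K : Matrix (Fin ((P.alice !a).mem (Fin.last r)))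
      (Fin ((P.alice a).mem (Fin.last r))) ℂ, IsContraction K ∧
      ∀ B : PureCoStrategy D, strategyFidelity (P.alice false) (P.alice true) ≤
        (K * crossReduced (finalState (P.alice !a) B) (finalState (P.alice a) B)).trace.re := by
    cases a
    · exact exists_contraction_strategyFidelity_swap _ _
    · exact exists_contraction_strategyFidelity _ _
  refine le_trans ?_ (P.convertingAlice a K hK).guaranteed_le_aliceCheatAfter
  obtain ⟨B, hB⟩ := P.bob_nonempty fun _ _ => false
  have : Nonempty {q : (Bool → BitString n) × PureCoStrategy D // q.2 ∈ P.bob q.1} :=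
    ⟨⟨(_, B), hB⟩⟩
  refine le_ciInf fun q => ?_
  exact (pow_le_pow_left₀ (strategyFidelity_nonneg _ _) (h _) 2).trans
    (P.sq_le_success_convertingAlice a hK q.2)

/-! ### Dishonest Bob -/

theorem CheatingBob.success_le_one (C : CheatingBob D) (P : OTProtocol D n) :
    C.success P ≤ 1 := by
  have h : ∀ a, bobProb (C.guess.elem a) (finalState (P.alice a) C.coStrategy) ≤ 1 := by
    intro a
    have h1 := re_trace_mul_nonneg (C.guess.posSemidef_one_sub a)
      (posSemidef_reduced (finalState (P.alice a) C.coStrategy))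
    rw [Matrix.sub_mul, Matrix.one_mul, Matrix.trace_sub, Complex.sub_re,
      re_trace_reduced_finalState] at h1
    rw [bobProb_eq_trace]
    linarith
  have h0 := h false
  have h1 := h true
  rw [CheatingBob.success, Fintype.sum_bool]
  linarith

theorem OTProtocol.two_le_fidelity_add_bobCheat (P : OTProtocol D n) (B : PureCoStrategy D) :
    2 ≤ fidelity (reduced (finalState (P.alice false) B)) (reduced (finalState (P.alice true) B))
      + 2 * P.bobCheat := by
  obtain ⟨M, hM, hM', h⟩ := exists_effect_le_fidelity
    (posSemidef_reduced (finalState (P.alice false) B))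
    (posSemidef_reduced (finalState (P.alice true) B))
  let C : CheatingBob D :=
    { coStrategy := B
      guess :=
        { elem := fun a => bif a then 1 - M else M
          posSemidef := by rintro (_ | _) <;> assumption
          sum_eq_one := by simp } }
  have hC : C.success P ≤ P.bobCheat :=
    le_ciSup (f := fun C : CheatingBob D => C.success P)
      ⟨1, by rintro _ ⟨C, rfl⟩; exact C.success_le_one P⟩ C
  simp only [CheatingBob.success, Fintype.sum_bool, bobProb_eq_trace, C, cond_true,
    cond_false] at hC
  rw [re_trace_reduced_finalState, re_trace_reduced_finalState] at h
  linarith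

theorem OTProtocol.two_le_strategyFidelity_add_bobCheat (P : OTProtocol D n) :
    2 ≤ strategyFidelity (P.alice false) (P.alice true) + 2 * P.bobCheat := by
  obtain ⟨B, -⟩ := P.bob_nonempty fun _ _ => false
  have : Nonempty (PureCoStrategy D) := ⟨B⟩
  have h : 2 - 2 * P.bobCheat ≤ strategyFidelity (P.alice false) (P.alice true) :=
    le_ciInf fun B => by linarith [P.two_le_fidelity_add_bobCheat B]
  linarith

end StrategyFidelity

end

/-! ### Combining the bounds for Alice and Bob -/

theorem mainTheorem7 {r n : ℕ} (D : StrategyFidelity.MessageSpaces r)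
    (P : StrategyFidelity.OTProtocol D n) :
    (∀ a : Bool, StrategyFidelity.strategyFidelity (P.alice false) (P.alice true) ^ 2
      ≤ P.aliceCheatAfter a) ∧
    StrategyFidelity.strategyFidelity (P.alice false) (P.alice true) ^ 2 ≤ P.aliceCheat ∧
    2 ≤ √P.aliceCheat + 2 * P.bobCheat ∧
    (9 - √17) / 8 ≤ max P.aliceCheat P.bobCheat := by
  have hA := P.sq_strategyFidelity_le_aliceCheatAfter
  have hA' : StrategyFidelity.strategyFidelity (P.alice false) (P.alice true) ^ 2
      ≤ P.aliceCheat := (hA true).trans (le_max_left _ _)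
  have hF : StrategyFidelity.strategyFidelity (P.alice false) (P.alice true) ≤ √P.aliceCheat :=
    Real.le_sqrt_of_sq_le hA'
  have hAB : 2 ≤ √P.aliceCheat + 2 * P.bobCheat := by
    linarith [P.two_le_strategyFidelity_add_bobCheat]
  refine ⟨hA, hA', hAB, ?_⟩
  set m := max P.aliceCheat P.bobCheat with hm
  have hm0 : 0 ≤ m := (sq_nonneg _).trans (hA'.trans (le_max_left _ _))
  have h1 : √P.aliceCheat ≤ √m := Real.sqrt_le_sqrt (le_max_left _ _)
  have h2 : P.bobCheat ≤ m := le_max_right _ _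
  have h3 : √m * √m = m := Real.mul_self_sqrt hm0
  have h4 : √(17 : ℝ) * √17 = 17 := Real.mul_self_sqrt (by norm_num)
  have h5 : 1 ≤ √(17 : ℝ) := Real.one_le_sqrt.2 (by norm_num)
  -- With `t = √m` the tradeoff reads `2 ≤ t + 2 * t ^ 2`; `(√17 - 1) / 4` is the positive root of
  -- equality, and its square is `(9 - √17) / 8`.
  have h6 : (√17 - 1) / 4 ≤ √m := by
    by_contra! hlt
    nlinarith [Real.sqrt_nonneg m]
  nlinarith
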